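/- **Proposition.** Let $M$ be a smooth $n$-dimensional manifold (Hausdorff, second countable), $\tau:T^*M\to M$ its cotangent bundle, $VT^*M=\ker d\tau$ the vertical distribution and $C^*=p_i\,\partial/\partial p_i$ the Liouville–Hamilton vector field on $T^*M$. Let $\mathcal N$ be a nonlinear connection, i.e. a smooth distribution $HT^*M$ with $T_uT^*M=H_uT^*M\oplus V_uT^*M$ for all $u\in T^*M$; let $h$ be the projector onto $HT^*M$ along $VT^*M$, $v=\mathrm{Id}-h$, and write also $\mathcal N=h-v$ for the associated $(1,1)$-tensor field. Let $[\cdot,\cdot]$ denote the Frölicher–Nijenhuis bracket of vector-valued forms, normalised so that for a vector field $X$ and a vector-valued form $L$ one has $[X,L]=\mathcal L_XL$, and for $(1,1)$-tensor fields $K,L$ $$[L,K](X,Y)=[LX,KY]+[KX,LY]+(LK+KL)[X,Y]-L[X,KY]-K[X,LY]-L[KX,Y]-K[LX,Y];$$ accordingly, for a vector-valued $1$-form $K$ and a vector-valued $2$-form $L$, $$[K,L](X,Y,Z)=\sum_{\mathrm{cyc}}\Big([KX,L(Y,Z)]+K[L(X,Y),Z]+L(K[X,Y],Z)+K\,L([X,Y],Z)-L([KX,Y],Z)+L([KX,Z],Y)\Big),$$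 the sum being over the cyclic permutations of $(X,Y,Z)$. Let $$\Omega=-\tfrac12[h,h],\qquad \mathbf t=\tfrac12\mathcal L_{C^*}\mathcal N\;(=[C^*,h])$$ be the curvature and the tension of $\mathcal N$. Then: 1. for every adapted almost tangent structure $\mathcal J$ on $T^*M$ (a smooth $(1,1)$-tensor field of rank $n$ with $\mathcal J^2=0$ and $\operatorname{Im}\mathcal J=\operatorname{Ker}\mathcal J=VT^*M$), with torsion $\mathcal T=[\mathcal J,h]$, $$[\mathcal J,\Omega]=[h,\mathcal T];$$ 2. $$[C^*,\Omega]=-[h,\mathbf t].$$ -/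

import Mathlib

open Bundle ContDiff Manifold VectorField

noncomputable section

/-! ### Vector fields, vector-valued forms and the Frölicher–Nijenhuis bracket -/

namespace FrolicherNijenhuis

section

variable {F : Type*} [NormedAddCommGroup F] [NormedSpace ℝ F]
  {H : Type*} [TopologicalSpace H] (I : ModelWithCorners ℝ F H)
  (N : Type*) [TopologicalSpace N] [ChartedSpace H N] [IsManifold I ∞ N]

/-- The space `𝔛(N)` of smooth vector fields on the manifold `N`. -/
abbrev VField := Cₛ^∞⟮I; F, (TangentSpace I : N → Type _)⟯

/-- Smooth `(1,1)`-tensor fields on `N`: smooth sections of the bundle `End(TN)`. -/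
abbrev Tensor11 :=
  Cₛ^∞⟮I; F →L[ℝ] F, (fun u : N ↦ TangentSpace I u →L[ℝ] TangentSpace I u)⟯

/-- Vector-valued 1-forms, as operations on smooth vector fields. -/
abbrev Form1 := VField I N → VField I N

/-- Vector-valued 2-forms, as operations on smooth vector fields. -/
abbrev Form2 := VField I N → VField I N → VField I N

/-- Vector-valued 3-forms, as operations on smooth vector fields. -/
abbrev Form3 := VField I N → VField I N → VField I N → VField I N

variable {I N}

/-- A smooth `(1,1)`-tensor field as a vector-valued 1-form: `(A X)(u) = A_u (X_u)`. -/
def Tensor11.form (A : Tensor11 I N) : Form1 I N := fun X ↦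
  ⟨fun u ↦ A u (X u), A.contMDiff.clm_bundle_apply X.contMDiff⟩

variable [CompleteSpace F]

/-- The Lie bracket `[X, Y]` of smooth vector fields. -/
instance : Bracket (VField I N) (VField I N) where
  bracket X Y := ⟨mlieBracket I X Y, by
    have h1 : IsManifold I (minSmoothness ℝ 2) N := by
      rw [minSmoothness_of_isRCLikeNormedField]; infer_instance
    have h2 : IsManifold I (((⊤ : ℕ∞) : WithTop ℕ∞) + 1) N := ‹IsManifold I ∞ N›
    exact ContDiff.mlieBracket_vectorField (n := ⊤) (m := ⊤) X.contMDiff Y.contMDiff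
      (by simp)⟩

/-- The Frölicher–Nijenhuis bracket `[X, L] = 𝓛_X L` of a vector field and a
vector-valued 1-form. -/
def bracket01 (X : VField I N) (L : Form1 I N) : Form1 I N := fun Y ↦
  ⁅X, L Y⁆ - L ⁅X, Y⁆

/-- The Frölicher–Nijenhuis bracket `[X, L] = 𝓛_X L` of a vector field and a
vector-valued 2-form. -/
def bracket02 (X : VField I N) (L : Form2 I N) : Form2 I N := fun Y Z ↦
  ⁅X, L Y Z⁆ - L ⁅X, Y⁆ Z - L Y ⁅X, Z⁆

/-- The Frölicher–Nijenhuis bracket `[L, K]` of two vector-valued 1-forms. -/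
def bracket11 (L K : Form1 I N) : Form2 I N := fun X Y ↦
  ⁅L X, K Y⁆ + ⁅K X, L Y⁆ + (L (K ⁅X, Y⁆) + K (L ⁅X, Y⁆))
    - L ⁅X, K Y⁆ - K ⁅X, L Y⁆ - L ⁅K X, Y⁆ - K ⁅L X, Y⁆

/-- The Frölicher–Nijenhuis bracket `[K, L]` of a vector-valued 1-form `K` and a
vector-valued 2-form `L`: the case `k = 1`, `l = 2` of the general formula for
`[K, L](X₁, …, X_{k+l})` in terms of Lie brackets of vector fields, each sum over the
permutations of `X, Y, Z` being written out by means of the antisymmetry of `L`. -/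
def bracket12 (K : Form1 I N) (L : Form2 I N) : Form3 I N := fun X Y Z ↦
  (⁅K X, L Y Z⁆ + ⁅K Y, L Z X⁆ + ⁅K Z, L X Y⁆)
    - (L ⁅K X, Y⁆ Z - L ⁅K X, Z⁆ Y + L ⁅K Y, Z⁆ X
      - L ⁅K Y, X⁆ Z + L ⁅K Z, X⁆ Y - L ⁅K Z, Y⁆ X)
    + (K ⁅L X Y, Z⁆ + K ⁅L Y Z, X⁆ + K ⁅L Z X, Y⁆)
    + (L (K ⁅X, Y⁆) Z + L (K ⁅Y, Z⁆) X + L (K ⁅Z, X⁆) Y)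
    + (K (L ⁅X, Y⁆ Z) + K (L ⁅Y, Z⁆ X) + K (L ⁅Z, X⁆ Y))

end

end FrolicherNijenhuis

/-! ### The cotangent bundle -/

namespace CotangentGeometry

open FrolicherNijenhuis

variable (n : ℕ) (M : Type*) [TopologicalSpace M] [ChartedSpace (EuclideanSpace ℝ (Fin n)) M]
  [IsManifold (𝓡 n) ∞ M]

/-- The cotangent bundle `T*M`, with Mathlib's vector bundle structure on the dual of `TM`. -/
abbrev CotangentBundle := TotalSpace (EuclideanSpace ℝ (Fin n) →L[ℝ] ℝ)
  (fun x : M ↦ TangentSpace (𝓡 n) x →L[ℝ] Bundle.Trivial M ℝ x)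

/-- The model vector space `ℝⁿ × (ℝⁿ)*` of `T*M`. -/
abbrev CModel := EuclideanSpace ℝ (Fin n) × (EuclideanSpace ℝ (Fin n) →L[ℝ] ℝ)

/-- The model with corners of `T*M`. -/
abbrev CI := (𝓡 n).prod 𝓘(ℝ, EuclideanSpace ℝ (Fin n) →L[ℝ] ℝ)

variable {n M}

/-- The vertical subspace `V_u T*M`: the kernel of the differential of `τ : T*M → M` at `u`. -/
def vertical (u : CotangentBundle n M) : Submodule ℝ (TangentSpace (CI n) u) :=
  LinearMap.ker (mfderiv (CI n) (𝓡 n)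
    (TotalSpace.proj : CotangentBundle n M → M) u).toLinearMap

/-- Fibrewise multiplication `(x, p) ↦ (x, t p)` on `T*M`. -/
def dilation (t : ℝ) (u : CotangentBundle n M) : CotangentBundle n M := ⟨u.proj, t • u.snd⟩

lemma contMDiff_dilation :
    ContMDiff (𝓘(ℝ, ℝ).prod (CI n)) (CI n) ∞
      (fun q : ℝ × CotangentBundle n M ↦ dilation q.1 q.2) := by
  intro q₀
  have hproj : ContMDiff (𝓘(ℝ, ℝ).prod (CI n)) (𝓡 n) ∞
      (fun q : ℝ × CotangentBundle n M ↦ q.2.proj) :=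
    (contMDiff_proj (IB := 𝓡 n) (fun x : M ↦ TangentSpace (𝓡 n) x →L[ℝ] Bundle.Trivial M ℝ x)).comp
      contMDiff_snd
  rw [contMDiffAt_totalSpace]
  refine ⟨hproj q₀, ?_⟩
  set e := trivializationAt (EuclideanSpace ℝ (Fin n) →L[ℝ] ℝ)
    (fun x : M ↦ TangentSpace (𝓡 n) x →L[ℝ] Bundle.Trivial M ℝ x) q₀.2.proj
  have h2 : ContMDiffAt (𝓘(ℝ, ℝ).prod (CI n)) 𝓘(ℝ, EuclideanSpace ℝ (Fin n) →L[ℝ] ℝ) ∞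
      (fun q : ℝ × CotangentBundle n M ↦ (e q.2).2) q₀ :=
    ((contMDiffAt_totalSpace (f := fun q : ℝ × CotangentBundle n M ↦ q.2)).1
      contMDiffAt_snd).2
  refine (contMDiffAt_fst.smul h2).congr_of_eventuallyEq ?_
  have hmem : ∀ᶠ q in nhds q₀, q.2.proj ∈ e.baseSet :=
    hproj.continuous.continuousAt.eventually
      (e.open_baseSet.mem_nhds (FiberBundle.mem_baseSet_trivializationAt' _))
  filter_upwards [hmem] with q hq
  exact (e.linear ℝ hq).2 q.1 q.2.snd

variable (n M) in
/-- The Liouville–Hamilton vector field `C* = pᵢ ∂/∂pᵢ`: its value at `u = (x, p)` is the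
velocity at `t = 1` of the curve `t ↦ (x, t p)`. -/
def liouville : VField (CI n) (CotangentBundle n M) :=
  ⟨fun u ↦ mfderiv 𝓘(ℝ, ℝ) (CI n) (fun t : ℝ ↦ dilation t u) 1 (1 : ℝ), by
    have h1 : ContMDiff (CI n) ((𝓘(ℝ, ℝ).prod (CI n)).prod 𝓘(ℝ, ℝ × CModel n)) ∞
        (fun u : CotangentBundle n M ↦
          (equivTangentBundleProd 𝓘(ℝ, ℝ) ℝ (CI n) (CotangentBundle n M)).symm
            (⟨1, (1 : ℝ)⟩, ⟨u, 0⟩)) :=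
      contMDiff_equivTangentBundleProd_symm.comp
        (contMDiff_const.prodMk (contMDiff_zeroSection ℝ _))
    have h2 := (contMDiff_dilation (n := n) (M := M)).contMDiff_tangentMap (m := ∞) (by simp)
    refine (h2.comp h1).congr fun u ↦ ?_
    have h3 : MDifferentiableAt (𝓘(ℝ, ℝ).prod (CI n)) (CI n)
        (fun q : ℝ × CotangentBundle n M ↦ dilation q.1 q.2) (1, u) :=
      (contMDiff_dilation (1, u)).mdifferentiableAt (by simp)
    have h4 : HasMFDerivAt 𝓘(ℝ, ℝ) (𝓘(ℝ, ℝ).prod (CI n)) (fun t : ℝ ↦ (t, u)) 1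
        ((ContinuousLinearMap.id ℝ (TangentSpace 𝓘(ℝ, ℝ) (1 : ℝ))).prod
          (0 : TangentSpace 𝓘(ℝ, ℝ) (1 : ℝ) →L[ℝ] TangentSpace (CI n) u)) :=
      (hasMFDerivAt_id _).prodMk (hasMFDerivAt_const _ _)
    have h5 := (h3.hasMFDerivAt.comp (1 : ℝ) h4).mfderiv
    have h6 : dilation (1 : ℝ) u = u := by simp [dilation]
    have h7 : ∀ (w : CotangentBundle n M) (X : CModel n), w = u →
        (⟨u, X⟩ : TangentBundle (CI n) (CotangentBundle n M)) = ⟨w, X⟩ := by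
      rintro w X rfl; rfl
    refine Eq.trans ?_ (h7 _ _ h6)
    exact congrArg (fun X : CModel n ↦
      (⟨u, X⟩ : TangentBundle (CI n) (CotangentBundle n M))) (DFunLike.congr_fun h5 (1 : ℝ))⟩

/-- The linear projector of `T_u T*M` onto `H` along a complement `V`. -/
def projector {u : CotangentBundle n M} {H V : Submodule ℝ (TangentSpace (CI n) u)}
    (hHV : IsCompl H V) : TangentSpace (CI n) u →L[ℝ] TangentSpace (CI n) u :=
  ⟨H.projection V hHV, by
    have : FiniteDimensional ℝ (TangentSpace (CI n) u) :=
      inferInstanceAs (FiniteDimensional ℝ (CModel n))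
    have : T2Space (TangentSpace (CI n) u) := inferInstanceAs (T2Space (CModel n))
    exact LinearMap.continuous_of_finiteDimensional _⟩

variable (n M) in
/-- A nonlinear connection: a smooth distribution `H` on `T*M` with
`T_u T*M = H_u ⊕ V_u` for all `u`. Smoothness is expressed by smoothness of the projector
onto `H` along the vertical distribution. -/
structure NonlinearConnection where
  horizontal : ∀ u : CotangentBundle n M, Submodule ℝ (TangentSpace (CI n) u)
  isCompl : ∀ u, IsCompl (horizontal u) (vertical u)
  smooth : ContMDiff (CI n) ((CI n).prod 𝓘(ℝ, CModel n →L[ℝ] CModel n)) ∞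
    (fun u ↦ TotalSpace.mk' (CModel n →L[ℝ] CModel n)
      (E := fun u : CotangentBundle n M ↦
        TangentSpace (CI n) u →L[ℝ] TangentSpace (CI n) u) u (projector (isCompl u)))


namespace NonlinearConnection

variable (𝒩 : NonlinearConnection n M)

/-- The horizontal projector `h` of a nonlinear connection, as a `(1,1)`-tensor field. -/
def hTensor : Tensor11 (CI n) (CotangentBundle n M) :=
  ⟨fun u ↦ projector (𝒩.isCompl u), 𝒩.smooth⟩

/-- The horizontal projector `h`, as a vector-valued 1-form. -/
def h : Form1 (CI n) (CotangentBundle n M) := 𝒩.hTensor.form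

/-- The vertical projector `v = Id - h`. -/
def v : Form1 (CI n) (CotangentBundle n M) := fun X ↦ X - 𝒩.h X

/-- The nonlinear connection as an almost product structure, `𝒩 = h - v`. -/
def form : Form1 (CI n) (CotangentBundle n M) := fun X ↦ 𝒩.h X - 𝒩.v X

/-- The curvature `Ω = -½ [h, h]`. -/
def curvature : Form2 (CI n) (CotangentBundle n M) :=
  (-(1 / 2 : ℝ)) • bracket11 𝒩.h 𝒩.h

/-- The tension `𝐭 = ½ 𝓛_{C*} 𝒩`. -/
def tension : Form1 (CI n) (CotangentBundle n M) :=
  (1 / 2 : ℝ) • bracket01 (liouville n M) 𝒩.form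

end NonlinearConnection

variable (n M) in
/-- An adapted almost tangent structure `J` on `T*M`: a smooth `(1,1)`-tensor field of rank `n`
with `J² = 0` and `Im J = Ker J = V T*M`. -/
structure AdaptedAlmostTangentStructure where
  tensor : Tensor11 (CI n) (CotangentBundle n M)
  rank_eq : ∀ u, LinearMap.rank (tensor u).toLinearMap = n
  sq_eq_zero : ∀ u (w : TangentSpace (CI n) u), tensor u (tensor u w) = 0
  range_eq : ∀ u, LinearMap.range (tensor u).toLinearMap = vertical u
  ker_eq : ∀ u, LinearMap.ker (tensor u).toLinearMap = vertical u

/-- An adapted almost tangent structure as a vector-valued 1-form. -/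
def AdaptedAlmostTangentStructure.form (J : AdaptedAlmostTangentStructure n M) :
    Form1 (CI n) (CotangentBundle n M) := J.tensor.form

/-- The torsion `𝒯 = [J, h]` of a nonlinear connection. -/
def NonlinearConnection.torsion (𝒩 : NonlinearConnection n M)
    (J : AdaptedAlmostTangentStructure n M) : Form2 (CI n) (CotangentBundle n M) :=
  bracket11 J.form 𝒩.h

end CotangentGeometry

end

open FrolicherNijenhuis CotangentGeometry

/-! ### Graded Jacobi identities over an abstract Lie ring -/

namespace FrolicherNijenhuis

/-! Both claims are graded Jacobi identities: `[J, [h, h]] = -2 [h, [J, h]]` and `[C*, [h, h]] = 2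
[h, [C*, h]]`, multiplied by `-½`. Evaluated on vector fields, they are formal consequences of
additivity of the operators and the Lie ring axioms. `graded_jacobi_lieRing` and
`graded_jacobi_vector_lieRing` prove them at that level; smooth vector fields are then shown to form
a Lie ring on which tensor fields act additively. -/

/-- The graded Jacobi identity for `[J, [h, h]]`, written out for additive endomorphisms of a
Lie ring, with `Ω = -½ [h, h]` and `T = [J, h]`. -/
theorem graded_jacobi_lieRing {L : Type*} [LieRing L] (h J : L →+ L) (Ω T : L → L → L)
    (hΩ : ∀ X Y, Ω X Y = -(⁅h X, h Y⁆ + h (h ⁅X, Y⁆) - h ⁅X, h Y⁆ - h ⁅h X, Y⁆))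
    (hT : ∀ X Y, T X Y = ⁅J X, h Y⁆ + ⁅h X, J Y⁆ + (J (h ⁅X, Y⁆) + h (J ⁅X, Y⁆))
      - J ⁅X, h Y⁆ - h ⁅X, J Y⁆ - J ⁅h X, Y⁆ - h ⁅J X, Y⁆) (X Y Z : L) :
    (⁅J X, Ω Y Z⁆ + ⁅J Y, Ω Z X⁆ + ⁅J Z, Ω X Y⁆)
      - (Ω ⁅J X, Y⁆ Z - Ω ⁅J X, Z⁆ Y + Ω ⁅J Y, Z⁆ X
        - Ω ⁅J Y, X⁆ Z + Ω ⁅J Z, X⁆ Y - Ω ⁅J Z, Y⁆ X)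
      + (J ⁅Ω X Y, Z⁆ + J ⁅Ω Y Z, X⁆ + J ⁅Ω Z X, Y⁆)
      + (Ω (J ⁅X, Y⁆) Z + Ω (J ⁅Y, Z⁆) X + Ω (J ⁅Z, X⁆) Y)
      + (J (Ω ⁅X, Y⁆ Z) + J (Ω ⁅Y, Z⁆ X) + J (Ω ⁅Z, X⁆ Y)) =
    (⁅h X, T Y Z⁆ + ⁅h Y, T Z X⁆ + ⁅h Z, T X Y⁆)
      - (T ⁅h X, Y⁆ Z - T ⁅h X, Z⁆ Y + T ⁅h Y, Z⁆ X
        - T ⁅h Y, X⁆ Z + T ⁅h Z, X⁆ Y - T ⁅h Z, Y⁆ X)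
      + (h ⁅T X Y, Z⁆ + h ⁅T Y Z, X⁆ + h ⁅T Z X, Y⁆)
      + (T (h ⁅X, Y⁆) Z + T (h ⁅Y, Z⁆) X + T (h ⁅Z, X⁆) Y)
      + (h (T ⁅X, Y⁆ Z) + h (T ⁅Y, Z⁆ X) + h (T ⁅Z, X⁆ Y)) := by
  -- Jacobi, oriented to bring the Z-slot `c` inside: with antisymmetry, every triple bracket
  -- reduces to `⁅a, ⁅b, c⁆⁆` and `⁅b, ⁅a, c⁆⁆`, which satisfy no further relation in a free Lie
  -- ring.
  have j : ∀ a b c : L, ⁅c, ⁅a, b⁆⁆ = ⁅a, ⁅c, b⁆⁆ - ⁅b, ⁅c, a⁆⁆ := fun a b c ↦ by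
    rw [leibniz_lie c a b, ← lie_skew b ⁅c, a⁆]; abel
  have s : ∀ a b : L, ⁅b, a⁆ = -⁅a, b⁆ := fun a b ↦ (lie_skew _ _).symm
  -- These move an inner bracket, bare or under operators, to the right-hand argument.
  have e : ∀ a b c : L, ⁅⁅a, b⁆, c⁆ = -⁅c, ⁅a, b⁆⁆ := fun _ _ _ ↦ s _ _
  have eh : ∀ a b c : L, ⁅h ⁅a, b⁆, c⁆ = -⁅c, h ⁅a, b⁆⁆ := fun _ _ _ ↦ s _ _
  have eJ : ∀ a b c : L, ⁅J ⁅a, b⁆, c⁆ = -⁅c, J ⁅a, b⁆⁆ := fun _ _ _ ↦ s _ _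
  have ehh : ∀ a b c : L, ⁅h (h ⁅a, b⁆), c⁆ = -⁅c, h (h ⁅a, b⁆)⁆ := fun _ _ _ ↦ s _ _
  have eJh : ∀ a b c : L, ⁅J (h ⁅a, b⁆), c⁆ = -⁅c, J (h ⁅a, b⁆)⁆ := fun _ _ _ ↦ s _ _
  have ehJ : ∀ a b c : L, ⁅h (J ⁅a, b⁆), c⁆ = -⁅c, h (J ⁅a, b⁆)⁆ := fun _ _ _ ↦ s _ _
  simp only [hΩ, hT, map_add, map_sub, map_neg, lie_add, lie_sub, lie_neg, add_lie, sub_lie,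
    neg_lie, e, eh, eJ, ehh, eJh, ehJ]
  -- Antisymmetry is used only at explicit instances, putting arguments in the order X, Y, Z; as a
  -- general rewrite rule it would loop.
  simp only [s X (h Y), s X (J Y), s X Z, s X (h Z), s X (J Z), s (h X) Z, s (h X) (h Z),
    s (h X) (J Z), s (J X) Z, s (J X) (h Z), s Y (h Z), s Y (J Z), map_neg, lie_neg]
  simp only [j X Y Z, j X Y (h Z), j X Y (J Z), j X (h Y) Z, j X (h Y) (h Z), j X (h Y) (J Z),
    j X (J Y) Z, j X (J Y) (h Z), j (h X) Y Z, j (h X) Y (h Z), j (h X) Y (J Z), j (h X) (h Y) Z,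
    j (h X) (h Y) (J Z), j (h X) (J Y) Z, j (h X) (J Y) (h Z), j (J X) Y Z, j (J X) Y (h Z),
    j (J X) (h Y) Z, j (J X) (h Y) (h Z), s X Z, s X (h Z), s X (J Z), s (h X) Z,
    s (h X) (h Z), s (h X) (J Z), s (J X) Z, s (J X) (h Z), s Y Z, s Y (h Z), s Y (J Z),
    s (h Y) Z, s (h Y) (h Z), s (h Y) (J Z), s (J Y) Z, s (J Y) (h Z), map_neg, map_sub, lie_neg]
  abel

/-- The graded Jacobi identity for `[C, [h, h]]`, written out for an additive endomorphism of a
Lie ring, with `Ω = -½ [h, h]` and `t = [C, h]`. -/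
theorem graded_jacobi_vector_lieRing {L : Type*} [LieRing L] (C : L) (h : L →+ L)
    (Ω : L → L → L) (t : L → L)
    (hΩ : ∀ X Y, Ω X Y = -(⁅h X, h Y⁆ + h (h ⁅X, Y⁆) - h ⁅X, h Y⁆ - h ⁅h X, Y⁆))
    (ht : ∀ X, t X = ⁅C, h X⁆ - h ⁅C, X⁆) (X Y : L) :
    ⁅C, Ω X Y⁆ - Ω ⁅C, X⁆ Y - Ω X ⁅C, Y⁆ =
      -(⁅h X, t Y⁆ + ⁅t X, h Y⁆ + (h (t ⁅X, Y⁆) + t (h ⁅X, Y⁆))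
        - h ⁅X, t Y⁆ - t ⁅X, h Y⁆ - h ⁅t X, Y⁆ - t ⁅h X, Y⁆) := by
  -- Here `leibniz_lie C` says that bracketing with `C` is a derivation, the only form of Jacobi
  -- needed.
  simp only [hΩ, ht, map_add, map_sub, lie_add, lie_sub, lie_neg, sub_lie, leibniz_lie C]
  abel

/-! ### The Lie ring of smooth vector fields -/

section

variable {F : Type*} [NormedAddCommGroup F] [NormedSpace ℝ F]
  {H : Type*} [TopologicalSpace H] {I : ModelWithCorners ℝ F H}
  {N : Type*} [TopologicalSpace N] [ChartedSpace H N] [IsManifold I ∞ N]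

/-- A smooth `(1,1)`-tensor field as an additive endomorphism of the vector fields. -/
noncomputable def Tensor11.formHom (A : Tensor11 I N) : VField I N →+ VField I N :=
  AddMonoidHom.mk' A.form fun X Y ↦ by ext u; exact (A u).map_add (X u) (Y u)

variable [CompleteSpace F]

theorem VField.lie_swap (X Y : VField I N) : ⁅X, Y⁆ = -⁅Y, X⁆ := by
  ext u; exact mlieBracket_swap_apply

theorem VField.lie_add (X Y Z : VField I N) : ⁅X, Y + Z⁆ = ⁅X, Y⁆ + ⁅X, Z⁆ := by
  have h1 : IsManifold I (minSmoothness ℝ 2) N := by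
    rw [minSmoothness_of_isRCLikeNormedField]; infer_instance
  ext u
  exact mlieBracket_add_right ((Y.contMDiff u).mdifferentiableAt (by simp))
    ((Z.contMDiff u).mdifferentiableAt (by simp))

/-- Smooth vector fields form a Lie ring. -/
noncomputable instance : LieRing (VField I N) where
  add_lie X Y Z := by
    rw [VField.lie_swap, VField.lie_add, VField.lie_swap Z X, VField.lie_swap Z Y]; abel
  lie_add := VField.lie_add
  lie_self X := by ext u; exact congrFun mlieBracket_self u
  leibniz_lie X Y Z := by
    have h1 : IsManifold I (minSmoothness ℝ 3) N := by
      rw [minSmoothness_of_isRCLikeNormedField]; infer_instance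
    have h2 : minSmoothness ℝ 2 ≤ ∞ := by
      rw [minSmoothness_of_isRCLikeNormedField]; exact WithTop.coe_le_coe.2 le_top
    ext u
    exact leibniz_identity_mlieBracket_apply ((X.contMDiff u).of_le h2)
      ((Y.contMDiff u).of_le h2) ((Z.contMDiff u).of_le h2)

/-- Each term of `[h, h]` occurs twice, so the factor ½ cancels and the result makes sense in a Lie
ring without scalars. -/
theorem neg_half_smul_bracket11_self (h : Form1 I N) (X Y : VField I N) :
    (-(1 / 2 : ℝ)) • bracket11 h h X Y =
      -(⁅h X, h Y⁆ + h (h ⁅X, Y⁆) - h ⁅X, h Y⁆ - h ⁅h X, Y⁆) := by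
  unfold bracket11
  module

/-- The tensor is `2h - Id`, and the Lie derivative of `Id` vanishes. -/
theorem half_smul_bracket01_almost_product (C : VField I N) (h : Form1 I N) (X : VField I N) :
    (1 / 2 : ℝ) • bracket01 C (fun X ↦ h X - (X - h X)) X = ⁅C, h X⁆ - h ⁅C, X⁆ := by
  unfold bracket01
  simp only [lie_sub]
  module

end

end FrolicherNijenhuis

namespace CotangentGeometry

variable {n : ℕ} {M : Type*} [TopologicalSpace M]
  [ChartedSpace (EuclideanSpace ℝ (Fin n)) M] [IsManifold (𝓡 n) ∞ M]

theorem NonlinearConnection.curvature_apply (𝒩 : NonlinearConnection n M)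
    (X Y : VField (CI n) (CotangentBundle n M)) :
    𝒩.curvature X Y =
      -(⁅𝒩.h X, 𝒩.h Y⁆ + 𝒩.h (𝒩.h ⁅X, Y⁆) - 𝒩.h ⁅X, 𝒩.h Y⁆ - 𝒩.h ⁅𝒩.h X, Y⁆) :=
  neg_half_smul_bracket11_self 𝒩.h X Y

/-- The tension is `[C*, h]`. -/
theorem NonlinearConnection.tension_apply (𝒩 : NonlinearConnection n M)
    (X : VField (CI n) (CotangentBundle n M)) :
    𝒩.tension X = ⁅liouville n M, 𝒩.h X⁆ - 𝒩.h ⁅liouville n M, X⁆ :=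
  half_smul_bracket01_almost_product (liouville n M) 𝒩.h X

end CotangentGeometry

open FrolicherNijenhuis CotangentGeometry
theorem mainTheorem7 (n : ℕ) (M : Type*) [TopologicalSpace M] [T2Space M]
    [SecondCountableTopology M] [ChartedSpace (EuclideanSpace ℝ (Fin n)) M]
    [IsManifold (𝓡 n) ∞ M] (𝒩 : NonlinearConnection n M) :
    (∀ J : AdaptedAlmostTangentStructure n M,
      bracket12 J.form 𝒩.curvature = bracket12 𝒩.h (𝒩.torsion J)) ∧
    bracket02 (liouville n M) 𝒩.curvature = -bracket11 𝒩.h 𝒩.tension := by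
  refine ⟨fun J ↦ ?_, ?_⟩
  · funext X Y Z
    -- The brackets of forms and the coercion of `formHom` unfold definitionally to the abstract
    -- expressions.
    exact graded_jacobi_lieRing 𝒩.hTensor.formHom J.tensor.formHom 𝒩.curvature (𝒩.torsion J)
      𝒩.curvature_apply (fun _ _ ↦ rfl) X Y Z
  · funext X Y
    exact graded_jacobi_vector_lieRing (liouville n M) 𝒩.hTensor.formHom 𝒩.curvature 𝒩.tension
      𝒩.curvature_apply 𝒩.tension_apply X Y
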